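/- For positive integers $a,b,c$ and nonzero elements $u,v,w$ of a field define the Dedekind--Rademacher--Carlitz sum \[ \mathrm{drc}(u,v,w;a,b,c) := \sum_{k=0}^{c-1}\sum_{j=0}^{b-1} u^{\left\lfloor \frac{ja}{b}+\frac{ka}{c}\right\rfloor} v^j w^k , \] and for a bounded set $P\subseteq\mathbb{R}^3$ let $\sigma_P(u,v,w) := \sum_{(m_1,m_2,m_3)\in P\cap\mathbb{Z}^3} u^{m_1}v^{m_2}w^{m_3}$ be its integer-point transform. Theorem. Let $a,b,c$ be pairwise relatively prime positive integers, let $\mathcal{T}\subset\mathbb{R}^3$ be the convex hull of $(a,0,0)$, $(0,b,0)$, $(0,0,c)$ and $(0,0,0)$, and let $t$ be a positive integer. Then for all nonzero elements $u,v,w$ of any field (in particular for indeterminates $u,v,w$, taken in a field of rational functions), \begin{align*} &(u-1)(v-1)(w-1)(u^a-v^b)(u^a-w^c)(v^b-w^c)\,\sigma_{t\mathcal{T}}(u,v,w) \\ &\quad = u^{(t+2)a}(v-1)(w-1)(v^b-w^c)\bigl((u-1)+\mathrm{drc}(u^{-1},v,w;a,b,c)\bigr) \\ &\qquad - v^{(t+2)b}(u-1)(w-1)(u^a-w^c)\bigl((v-1)+\mathrm{drc}(v^{-1},u,w;b,a,c)\bigr)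 \\ &\qquad + w^{(t+2)c}(u-1)(v-1)(u^a-v^b)\bigl((w-1)+\mathrm{drc}(w^{-1},u,v;c,a,b)\bigr) \\ &\qquad - (u^a-v^b)(u^a-w^c)(v^b-w^c). \end{align*} -/

import Mathlib

open scoped Pointwise

/-- The set of integer points `P ∩ ℤ^d` of a subset `P` of `ℝ^d`. -/
def integerPoints {d : ℕ} (P : Set (Fin d → ℝ)) : Set (Fin d → ℤ) :=
  {m | (fun i => (m i : ℝ)) ∈ P}

/-- The integer-point transform `σ_P(z) = ∑_{m ∈ P ∩ ℤ^d} z₁^{m₁} ⋯ z_d^{m_d}` of a bounded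
subset `P` of `ℝ^d` (for which the sum is finite), with values in an arbitrary field; taking
`z₁, …, z_d` to be the variables of a field of rational functions gives the transform in
indeterminates. -/
noncomputable def integerPointTransform {K : Type*} [Field K] {d : ℕ}
    (P : Set (Fin d → ℝ)) (z : Fin d → K) : K :=
  ∑ᶠ m ∈ integerPoints P, ∏ i, z i ^ m i

/-- A bounded set has only finitely many integer points, so its integer-point transform
is a genuine finite sum. -/
theorem integerPoints_finite {d : ℕ} {P : Set (Fin d → ℝ)} (hP : Bornology.IsBounded P) :
    (integerPoints P).Finite := by
  obtain ⟨r, hr⟩ := hP.exists_norm_le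
  refine Set.Finite.subset (Set.finite_Icc (fun _ => -⌈r⌉) (fun _ => ⌈r⌉)) ?_
  intro m hm
  have h1 : ∀ i, |(m i : ℝ)| ≤ ⌈r⌉ := fun i =>
    ((norm_le_pi_norm (fun i => (m i : ℝ)) i).trans (hr _ hm)).trans (Int.le_ceil r)
  refine ⟨fun i => ?_, fun i => ?_⟩
  · have := (abs_le.1 (h1 i)).1
    exact_mod_cast this
  · have := (abs_le.1 (h1 i)).2
    exact_mod_cast this

/-- The tetrahedron in `ℝ³` that is the convex hull of
`(a,0,0)`, `(0,b,0)`, `(0,0,c)` and `(0,0,0)`. -/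
def tetrahedron (a b c : ℕ) : Set (Fin 3 → ℝ) :=
  convexHull ℝ {![(a : ℝ), 0, 0], ![0, (b : ℝ), 0], ![0, 0, (c : ℝ)], ![0, 0, 0]}

/-- The Dedekind–Rademacher–Carlitz sum
`drc(u,v,w;a,b,c) = ∑_{k=0}^{c-1} ∑_{j=0}^{b-1} u^⌊ja/b + ka/c⌋ v^j w^k`. -/
def drc {K : Type*} [Field K] (u v w : K) (a b c : ℕ) : K :=
  ∑ k ∈ Finset.range c, ∑ j ∈ Finset.range b,
    u ^ ⌊((j : ℚ) * a / b + (k : ℚ) * a / c)⌋ * v ^ j * w ^ k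

/-!
Write `A = u ^ a`, `B = v ^ b`, `C = w ^ c`, and let `S t` be the integer-point transform of the
`t`-th dilate of the tetrahedron. The points of the `(t + 1)`-st dilate with `x ≥ a` are the
translates by `(a, 0, 0)` of the points of the `t`-th one; hence `S (t + 1) - A * S t` is the sum
over the points with `x < a`. Repeating this with `B` and `C` shows that
`S (t + 3) - (A + B + C) S (t + 2) + (AB + AC + BC) S (t + 1) - ABC S t` is the sum over the
points of the box `x < a`, `y < b`, `z < c` lying in the `(t + 3)`-rd dilate
(`simplexSum_add_three`). That is the whole box, whose sum is a product of three geometric sums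
(`boxSum_eq_of_three_le`). The recurrence thus determines `S` from `S 0`, `S 1`, `S 2`, which
only involve the box points of the first two dilates, and `simplexSum_formula` is its solution,
multiplied by `(u - 1) (v - 1) (w - 1)` and the Vandermonde product of `A`, `B`, `C`. Because
nothing is ever cancelled, degenerate values such as `u = 1` or `A = B` need no separate
treatment.

The arithmetic is in `pow_mul_drc_inv`, which expresses `A ^ 2 * drc u⁻¹ v w a b c` through the
box sums of the first two dilates. Above a fixed `(j, k)` the box points of the `s`-th dilate
form a segment whose length is governed by `⌊ja/b + ka/c⌋`; pairwise coprimality ensures that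
`ja/b + ka/c` is an integer only for `j = k = 0` (`box_le_iff`). Since the box sums are symmetric
in the three coordinates, the same lemma handles all three Dedekind–Rademacher–Carlitz sums.
-/

/-! ### Natural points of the dilated tetrahedron -/

/-- The points `(x, y, z) ∈ ℕ³` with `x / a + y / b + z / c ≤ t`, the inequality being cleared
of denominators. The surrounding box only serves to make the set visibly finite. -/
def simplexPoints (a b c t : ℕ) : Finset (ℕ × ℕ × ℕ) :=
  (Finset.range (t * a + 1) ×ˢ Finset.range (t * b + 1) ×ˢ Finset.range (t * c + 1)).filter
    fun m => m.1 * (b * c) + m.2.1 * (a * c) + m.2.2 * (a * b) ≤ t * (a * b * c)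

theorem mem_simplexPoints {a b c : ℕ} (ha : 0 < a) (hb : 0 < b) (hc : 0 < c) {t : ℕ}
    {m : ℕ × ℕ × ℕ} : m ∈ simplexPoints a b c t ↔
      m.1 * (b * c) + m.2.1 * (a * c) + m.2.2 * (a * b) ≤ t * (a * b * c) := by
  obtain ⟨x, y, z⟩ := m
  simp only [simplexPoints, Finset.mem_filter, Finset.mem_product, Finset.mem_range,
    and_iff_right_iff_imp, Nat.lt_succ_iff]
  intro h
  refine ⟨?_, ?_, ?_⟩
  · refine Nat.le_of_mul_le_mul_right (c := b * c) ?_ (by positivity)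
    calc x * (b * c) ≤ t * (a * b * c) := by omega
      _ = t * a * (b * c) := by ring
  · refine Nat.le_of_mul_le_mul_right (c := a * c) ?_ (by positivity)
    calc y * (a * c) ≤ t * (a * b * c) := by omega
      _ = t * b * (a * c) := by ring
  · refine Nat.le_of_mul_le_mul_right (c := a * b) ?_ (by positivity)
    calc z * (a * b) ≤ t * (a * b * c) := by omega
      _ = t * c * (a * b) := by ring

theorem mem_tetrahedron {a b c : ℕ} (ha : 0 < a) (hb : 0 < b) (hc : 0 < c) (p : Fin 3 → ℝ) :
    p ∈ tetrahedron a b c ↔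
      0 ≤ p 0 ∧ 0 ≤ p 1 ∧ 0 ≤ p 2 ∧ p 0 / a + p 1 / b + p 2 / c ≤ 1 := by
  have ha' : (0 : ℝ) < a := by exact_mod_cast ha
  have hb' : (0 : ℝ) < b := by exact_mod_cast hb
  have hc' : (0 : ℝ) < c := by exact_mod_cast hc
  constructor
  · intro hp
    have hconv : Convex ℝ {p : Fin 3 → ℝ |
        0 ≤ p 0 ∧ 0 ≤ p 1 ∧ 0 ≤ p 2 ∧ p 0 / a + p 1 / b + p 2 / c ≤ 1} := by
      rintro p ⟨hp0, hp1, hp2, hp⟩ q ⟨hq0, hq1, hq2, hq⟩ r s hr hs hrs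
      simp only [Set.mem_ofPred_eq, Pi.add_apply, Pi.smul_apply, smul_eq_mul]
      refine ⟨by positivity, by positivity, by positivity, ?_⟩
      calc (r * p 0 + s * q 0) / a + (r * p 1 + s * q 1) / b + (r * p 2 + s * q 2) / c
          = r * (p 0 / a + p 1 / b + p 2 / c) + s * (q 0 / a + q 1 / b + q 2 / c) := by ring
        _ ≤ r * 1 + s * 1 := by gcongr
        _ = 1 := by linarith
    refine convexHull_min ?_ hconv hp
    rintro q (rfl | rfl | rfl | rfl) <;>
      simp [ha'.ne', hb'.ne', hc'.ne']
  · rintro ⟨h0, h1, h2, h⟩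
    have key := (convex_convexHull ℝ ({![(a : ℝ), 0, 0], ![0, (b : ℝ), 0], ![0, 0, (c : ℝ)],
      ![0, 0, 0]} : Set (Fin 3 → ℝ))).sum_mem (t := Finset.univ)
      (w := ![p 0 / a, p 1 / b, p 2 / c, 1 - (p 0 / a + p 1 / b + p 2 / c)])
      (z := ![![(a : ℝ), 0, 0], ![0, (b : ℝ), 0], ![0, 0, (c : ℝ)], ![0, 0, 0]])
      (by
        intro i _
        fin_cases i
        · exact div_nonneg h0 ha'.le
        · exact div_nonneg h1 hb'.le
        · exact div_nonneg h2 hc'.le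
        · exact sub_nonneg.2 h)
      (by simp [Fin.sum_univ_four])
      (by
        intro i _
        apply subset_convexHull
        fin_cases i <;> simp)
    rw [tetrahedron]
    convert key
    ext i
    fin_cases i <;> simp [Fin.sum_univ_four, ha'.ne', hb'.ne', hc'.ne']

theorem integerPoints_smul_tetrahedron {a b c : ℕ} (ha : 0 < a) (hb : 0 < b) (hc : 0 < c)
    {t : ℕ} (ht : 0 < t) :
    integerPoints ((t : ℝ) • tetrahedron a b c) =
      (fun m : ℕ × ℕ × ℕ => (![(m.1 : ℤ), (m.2.1 : ℤ), (m.2.2 : ℤ)] : Fin 3 → ℤ)) ''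
        (simplexPoints a b c t : Set (ℕ × ℕ × ℕ)) := by
  have ha' : (0 : ℝ) < a := by exact_mod_cast ha
  have hb' : (0 : ℝ) < b := by exact_mod_cast hb
  have hc' : (0 : ℝ) < c := by exact_mod_cast hc
  have ht' : (0 : ℝ) < t := by exact_mod_cast ht
  have hineq (x y z : ℝ) : (t : ℝ)⁻¹ * x / a + (t : ℝ)⁻¹ * y / b + (t : ℝ)⁻¹ * z / c ≤ 1 ↔
      x * (b * c) + y * (a * c) + z * (a * b) ≤ t * (a * b * c) := by
    rw [show (t : ℝ)⁻¹ * x / a + (t : ℝ)⁻¹ * y / b + (t : ℝ)⁻¹ * z / c =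
      (x * (b * c) + y * (a * c) + z * (a * b)) / (t * (a * b * c)) by field_simp,
      div_le_one (by positivity)]
  ext m
  simp only [integerPoints, Set.mem_ofPred_eq, Set.mem_smul_set_iff_inv_smul_mem₀ ht'.ne',
    mem_tetrahedron ha hb hc, Pi.smul_apply, smul_eq_mul, hineq, Set.mem_image,
    Finset.mem_coe, mem_simplexPoints ha hb hc, mul_nonneg_iff_of_pos_left (inv_pos.2 ht'),
    Int.cast_nonneg_iff]
  constructor
  · rintro ⟨h0, h1, h2, h⟩
    refine ⟨((m 0).toNat, (m 1).toNat, (m 2).toNat), ?_, ?_⟩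
    · zify
      rw [Int.toNat_of_nonneg h0, Int.toNat_of_nonneg h1, Int.toNat_of_nonneg h2]
      exact_mod_cast h
    · ext i
      fin_cases i <;> simp [h0, h1, h2]
  · rintro ⟨⟨x, y, z⟩, h, rfl⟩
    refine ⟨by simp, by simp, by simp, ?_⟩
    simp only [Matrix.cons_val, Int.cast_natCast]
    exact_mod_cast h

/-- The weight `u ^ x * v ^ y * w ^ z` summed over the natural points `(x, y, z)` of the `t`-th
dilate of the tetrahedron that satisfy the extra condition `p`. -/
def simplexSum {K : Type*} [Field K] (u v w : K) (a b c t : ℕ)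
    (p : ℕ × ℕ × ℕ → Prop) [DecidablePred p] : K :=
  ∑ m ∈ (simplexPoints a b c t).filter p, u ^ m.1 * v ^ m.2.1 * w ^ m.2.2

theorem integerPointTransform_smul_tetrahedron {K : Type*} [Field K] (u v w : K) {a b c : ℕ}
    (ha : 0 < a) (hb : 0 < b) (hc : 0 < c) {t : ℕ} (ht : 0 < t) :
    integerPointTransform ((t : ℝ) • tetrahedron a b c) ![u, v, w] =
      simplexSum u v w a b c t fun _ => True := by
  rw [integerPointTransform, integerPoints_smul_tetrahedron ha hb hc ht, finsum_mem_image,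
    finsum_mem_coe_finset, simplexSum, Finset.filter_true]
  · refine Finset.sum_congr rfl fun m _ => ?_
    simp [Fin.prod_univ_three]
  · rintro ⟨x, y, z⟩ - ⟨x', y', z'⟩ - h
    have h0 := congrFun h 0
    have h1 := congrFun h 1
    have h2 := congrFun h 2
    simp at h0 h1 h2
    simp [h0, h1, h2]

/-! ### Removing translated copies of a smaller dilate -/

/-- If translation by `s` maps the points of the `t`-th dilate satisfying `p` bijectively onto
the points of the next dilate that satisfy `p` but not `q`, then the sum over the next dilate
splits accordingly. -/
theorem simplexSum_succ_of_translate {K : Type*} [Field K] (u v w : K) {a b c : ℕ} (t : ℕ)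
    (p q : ℕ × ℕ × ℕ → Prop) [DecidablePred p] [DecidablePred q] (s : ℕ × ℕ × ℕ)
    (hmem : ∀ m, m + s ∈ simplexPoints a b c (t + 1) ↔ m ∈ simplexPoints a b c t)
    (hp : ∀ m, p (m + s) ↔ p m) (hqp : ∀ m, q m → p m)
    (hq : ∀ m, p m → (¬ q m ↔ s ≤ m)) :
    simplexSum u v w a b c (t + 1) p = simplexSum u v w a b c (t + 1) q +
      u ^ s.1 * v ^ s.2.1 * w ^ s.2.2 * simplexSum u v w a b c t p := by
  rw [simplexSum, ← Finset.sum_filter_add_sum_filter_not _ q]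
  congr 1
  · rw [Finset.filter_filter, simplexSum]
    congr 1
    exact Finset.filter_congr fun m _ => ⟨And.right, fun h => ⟨hqp m h, h⟩⟩
  · rw [simplexSum, Finset.mul_sum]
    refine (Finset.sum_bij (fun m _ => m + s) ?_ ?_ ?_ ?_).symm
    · intro m hm
      rw [Finset.mem_filter] at hm
      have hpm := (hp m).2 hm.2
      simp only [Finset.mem_filter]
      exact ⟨⟨(hmem m).2 hm.1, hpm⟩, (hq _ hpm).2 le_add_self⟩
    · intro m _ m' _ h
      exact add_right_cancel h
    · intro m hm
      simp only [Finset.mem_filter] at hm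
      obtain ⟨⟨h1, h2⟩, h3⟩ := hm
      obtain ⟨n, rfl⟩ := exists_add_of_le ((hq m h2).1 h3)
      rw [add_comm s n] at h1 h2
      refine ⟨n, ?_, add_comm _ _⟩
      rw [Finset.mem_filter]
      exact ⟨(hmem n).1 h1, (hp n).1 h2⟩
    · intro m _
      simp only [Prod.fst_add, Prod.snd_add, pow_add]
      ring

theorem simplexSum_succ {K : Type*} [Field K] (u v w : K) {a b c : ℕ}
    (ha : 0 < a) (hb : 0 < b) (hc : 0 < c) (t : ℕ) :
    simplexSum u v w a b c (t + 1) (fun _ => True) =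
      simplexSum u v w a b c (t + 1) (fun m => m.1 < a) +
        u ^ a * simplexSum u v w a b c t (fun _ => True) := by
  have := simplexSum_succ_of_translate u v w (a := a) (b := b) (c := c) t
    (fun _ => True) (fun m => m.1 < a) (a, 0, 0)
    (fun m => by
      rw [mem_simplexPoints ha hb hc, mem_simplexPoints ha hb hc]
      simp only [Prod.fst_add, Prod.snd_add, add_mul, mul_assoc]
      omega)
    (fun m => Iff.rfl) (fun m _ => trivial)
    (fun m _ => by simp [Prod.le_def])
  simpa using this

theorem simplexSum_succ_fst_lt {K : Type*} [Field K] (u v w : K) {a b c : ℕ}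
    (ha : 0 < a) (hb : 0 < b) (hc : 0 < c) (t : ℕ) :
    simplexSum u v w a b c (t + 1) (fun m => m.1 < a) =
      simplexSum u v w a b c (t + 1) (fun m => m.1 < a ∧ m.2.1 < b) +
        v ^ b * simplexSum u v w a b c t (fun m => m.1 < a) := by
  have := simplexSum_succ_of_translate u v w (a := a) (b := b) (c := c) t
    (fun m => m.1 < a) (fun m => m.1 < a ∧ m.2.1 < b) (0, b, 0)
    (fun m => by
      rw [mem_simplexPoints ha hb hc, mem_simplexPoints ha hb hc]
      have : b * (a * c) = a * (b * c) := by ring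
      simp only [Prod.fst_add, Prod.snd_add, add_mul, mul_assoc, this]
      omega)
    (fun m => by simp) (fun m h => h.1)
    (fun m h => by simp [Prod.le_def, h])
  simpa using this

theorem simplexSum_succ_fst_snd_lt {K : Type*} [Field K] (u v w : K) {a b c : ℕ}
    (ha : 0 < a) (hb : 0 < b) (hc : 0 < c) (t : ℕ) :
    simplexSum u v w a b c (t + 1) (fun m => m.1 < a ∧ m.2.1 < b) =
      simplexSum u v w a b c (t + 1) (fun m => m.1 < a ∧ m.2.1 < b ∧ m.2.2 < c) +
        w ^ c * simplexSum u v w a b c t (fun m => m.1 < a ∧ m.2.1 < b) := by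
  have := simplexSum_succ_of_translate u v w (a := a) (b := b) (c := c) t
    (fun m => m.1 < a ∧ m.2.1 < b) (fun m => m.1 < a ∧ m.2.1 < b ∧ m.2.2 < c) (0, 0, c)
    (fun m => by
      rw [mem_simplexPoints ha hb hc, mem_simplexPoints ha hb hc]
      have : c * (a * b) = a * (b * c) := by ring
      simp only [Prod.fst_add, Prod.snd_add, add_mul, mul_assoc, this]
      omega)
    (fun m => by simp) (fun m h => ⟨h.1, h.2.1⟩)
    (fun m h => by simp [Prod.le_def, h])
  simpa using this

theorem simplexSum_zero {K : Type*} [Field K] (u v w : K) {a b c : ℕ}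
    (ha : 0 < a) (hb : 0 < b) (hc : 0 < c) (p : ℕ × ℕ × ℕ → Prop) [DecidablePred p]
    (hp : p 0) : simplexSum u v w a b c 0 p = 1 := by
  have : (simplexPoints a b c 0).filter p = {0} := by
    ext ⟨x, y, z⟩
    rw [Finset.mem_filter, mem_simplexPoints ha hb hc, Finset.mem_singleton, Prod.mk_eq_zero,
      Prod.mk_eq_zero]
    constructor
    · rintro ⟨h, -⟩
      simpa [ha.ne', hb.ne', hc.ne', and_assoc] using h
    · rintro ⟨rfl, rfl, rfl⟩
      exact ⟨by simp, hp⟩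
  rw [simplexSum, this]
  simp

/-! ### The points of a dilate inside the box -/

/-- The part of `simplexSum` over the box `x < a`, `y < b`, `z < c`, as an iterated sum. -/
def boxSum {K : Type*} [Field K] (u v w : K) (a b c s : ℕ) : K :=
  ∑ x ∈ Finset.range a, ∑ y ∈ Finset.range b, ∑ z ∈ Finset.range c,
    if x * (b * c) + y * (a * c) + z * (a * b) ≤ s * (a * b * c) then
      u ^ x * v ^ y * w ^ z else 0

theorem simplexSum_box {K : Type*} [Field K] (u v w : K) {a b c : ℕ}
    (ha : 0 < a) (hb : 0 < b) (hc : 0 < c) (t : ℕ) :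
    simplexSum u v w a b c t (fun m => m.1 < a ∧ m.2.1 < b ∧ m.2.2 < c) =
      boxSum u v w a b c t := by
  have hset : (simplexPoints a b c t).filter (fun m => m.1 < a ∧ m.2.1 < b ∧ m.2.2 < c) =
      (Finset.range a ×ˢ Finset.range b ×ˢ Finset.range c).filter fun m =>
        m.1 * (b * c) + m.2.1 * (a * c) + m.2.2 * (a * b) ≤ t * (a * b * c) := by
    ext m
    simp only [Finset.mem_filter, mem_simplexPoints ha hb hc, Finset.mem_product,
      Finset.mem_range]
    tauto
  rw [simplexSum, hset, Finset.sum_filter, Finset.sum_product]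
  exact Finset.sum_congr rfl fun x _ => Finset.sum_product _ _ _

theorem boxSum_swap_left {K : Type*} [Field K] (u v w : K) (a b c s : ℕ) :
    boxSum v u w b a c s = boxSum u v w a b c s := by
  rw [boxSum, Finset.sum_comm, boxSum]
  refine Finset.sum_congr rfl fun x _ => Finset.sum_congr rfl fun y _ =>
    Finset.sum_congr rfl fun z _ => ?_
  rw [mul_comm b a, mul_comm (v ^ y), add_comm (y * (a * c))]

theorem boxSum_swap_right {K : Type*} [Field K] (u v w : K) (a b c s : ℕ) :
    boxSum u w v a c b s = boxSum u v w a b c s := by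
  simp only [boxSum]
  refine Finset.sum_congr rfl fun x _ => ?_
  rw [Finset.sum_comm]
  refine Finset.sum_congr rfl fun y _ => Finset.sum_congr rfl fun z _ => ?_
  rw [mul_comm c b, mul_right_comm a c b, mul_right_comm _ (w ^ z), add_right_comm]

theorem boxSum_eq_of_three_le {K : Type*} [Field K] (u v w : K) (a b c : ℕ) {s : ℕ}
    (hs : 3 ≤ s) :
    (u - 1) * (v - 1) * (w - 1) * boxSum u v w a b c s =
      (u ^ a - 1) * (v ^ b - 1) * (w ^ c - 1) := by
  have : boxSum u v w a b c s = (∑ x ∈ Finset.range a, u ^ x) *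
      (∑ y ∈ Finset.range b, v ^ y) * ∑ z ∈ Finset.range c, w ^ z := by
    rw [boxSum, Finset.sum_mul_sum, Finset.sum_mul]
    refine Finset.sum_congr rfl fun x hx => ?_
    rw [Finset.sum_mul]
    refine Finset.sum_congr rfl fun y hy => ?_
    rw [Finset.mul_sum]
    refine Finset.sum_congr rfl fun z hz => if_pos ?_
    rw [Finset.mem_range] at hx hy hz
    calc x * (b * c) + y * (a * c) + z * (a * b)
        ≤ a * (b * c) + b * (a * c) + c * (a * b) := by gcongr
      _ = 3 * (a * b * c) := by ring
      _ ≤ s * (a * b * c) := by gcongr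
  rw [this, ← mul_geom_sum u a, ← mul_geom_sum v b, ← mul_geom_sum w c]
  ring

/-! ### The Dedekind–Rademacher–Carlitz sum as a count in the box -/

theorem floor_eq_natDiv (a b c j k : ℕ) (hb : 0 < b) (hc : 0 < c) :
    ⌊((j : ℚ) * a / b + (k : ℚ) * a / c)⌋ = ((a * (j * c + k * b) / (b * c) : ℕ) : ℤ) := by
  have hb' : (b : ℚ) ≠ 0 := by exact_mod_cast hb.ne'
  have hc' : (c : ℚ) ≠ 0 := by exact_mod_cast hc.ne'
  have : ((j : ℚ) * a / b + (k : ℚ) * a / c) =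
      ((a * (j * c + k * b) : ℕ) : ℚ) / ((b * c : ℕ) : ℚ) := by
    push_cast
    field_simp
  rw [this, Rat.floor_natCast_div_natCast]
  norm_cast

/-- Pairwise coprimality enters here: unless `j = k = 0`, the number `ja/b + ka/c` is not an
integer, so no point of the box lies on the boundary of the half-space. When `j = k = 0`, both
sides hold because `x < a` and `1 ≤ s`. -/
theorem box_le_iff {a b c : ℕ} (hb : 0 < b) (hc : 0 < c)
    (hab : Nat.Coprime a b) (hac : Nat.Coprime a c) (hbc : Nat.Coprime b c)
    {x j k s : ℕ} (hx : x < a) (hj : j < b) (hk : k < c) (hs : 1 ≤ s) :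
    x * (b * c) + j * (a * c) + k * (a * b) ≤ s * (a * b * c) ↔
      x + a * (j * c + k * b) / (b * c) < s * a := by
  have hbc0 : 0 < b * c := Nat.mul_pos hb hc
  have hM : x * (b * c) + j * (a * c) + k * (a * b) = x * (b * c) + a * (j * c + k * b) := by
    ring
  have hS : s * (a * b * c) = s * a * (b * c) := by ring
  rw [hM, hS]
  by_cases h0 : j = 0 ∧ k = 0
  · obtain ⟨rfl, rfl⟩ := h0
    have : x < s * a := hx.trans_le (Nat.le_mul_of_pos_left a hs)
    simp only [zero_mul, add_zero, mul_zero, Nat.zero_div, this, iff_true]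
    exact Nat.mul_le_mul_right _ this.le
  · have hnd : ¬ b * c ∣ a * (j * c + k * b) := by
      intro h
      have h' : b * c ∣ j * c + k * b :=
        (Nat.Coprime.mul_left hab.symm hac.symm).dvd_of_dvd_mul_left h
      apply h0
      constructor
      · have h1 : b ∣ j * c :=
          (Nat.dvd_add_left (Dvd.intro_left k rfl)).1 ((Dvd.intro c rfl).trans h')
        exact Nat.eq_zero_of_dvd_of_lt (hbc.dvd_of_dvd_mul_right h1) hj
      · have h1 : c ∣ k * b :=
          (Nat.dvd_add_right (Dvd.intro_left j rfl)).1 ((Dvd.intro_left b rfl).trans h')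
        exact Nat.eq_zero_of_dvd_of_lt (hbc.symm.dvd_of_dvd_mul_right h1) hk
    have hr : 0 < a * (j * c + k * b) % (b * c) :=
      Nat.pos_of_ne_zero fun h => hnd (Nat.dvd_of_mod_eq_zero h)
    have hr' := Nat.mod_lt (a * (j * c + k * b)) hbc0
    have hdm := Nat.div_add_mod (a * (j * c + k * b)) (b * c)
    generalize a * (j * c + k * b) / (b * c) = f at *
    generalize a * (j * c + k * b) % (b * c) = r at *
    rw [← hdm]
    constructor
    · intro h
      by_contra! hlt
      have := Nat.mul_le_mul_right (b * c) hlt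
      rw [add_mul, mul_comm f] at this
      omega
    · intro h
      have := Nat.mul_le_mul_right (b * c) (Nat.succ_le_of_lt h)
      rw [Nat.succ_mul, add_mul, mul_comm f] at this
      omega

theorem sub_one_mul_sum_ite {K : Type*} [Field K] (u : K) (a n f : ℕ) :
    (u - 1) * ∑ x ∈ Finset.range a, (if x + f < n then u ^ x else 0) =
      u ^ min a (n - f) - 1 := by
  rw [← Finset.sum_filter, ← mul_geom_sum u]
  congr 2
  ext x
  simp only [Finset.mem_filter, Finset.mem_range]
  omega

/-- The link between the Dedekind–Rademacher–Carlitz sum and the box points of the first two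
dilates. For fixed `j`, `k` with `f = ⌊ja/b + ka/c⌋ < 2a`, the box points above `(j, k)` form the
segments of lengths `min a (a - f)` and `min a (2a - f)` (truncated subtraction). If `f ≤ a` the
second one is full, otherwise the first one is empty. -/
theorem pow_mul_drc_inv {K : Type*} [Field K] {u : K} (v w : K) (hu : u ≠ 0) {a b c : ℕ}
    (hb : 0 < b) (hc : 0 < c)
    (hab : Nat.Coprime a b) (hac : Nat.Coprime a c) (hbc : Nat.Coprime b c) :
    (v - 1) * (w - 1) * ((u ^ a) ^ 2 * drc u⁻¹ v w a b c) =
      (u - 1) * (v - 1) * (w - 1) *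
        (u ^ a * boxSum u v w a b c 1 + boxSum u v w a b c 2) + (v ^ b - 1) * (w ^ c - 1) := by
  have hbox (s : ℕ) (hs : 1 ≤ s) : (u - 1) * boxSum u v w a b c s =
      ∑ k ∈ Finset.range c, ∑ j ∈ Finset.range b,
        (u ^ min a (s * a - a * (j * c + k * b) / (b * c)) - 1) * v ^ j * w ^ k := by
    rw [boxSum, Finset.sum_comm, Finset.sum_congr rfl fun y _ => Finset.sum_comm,
      Finset.sum_comm, Finset.mul_sum]
    refine Finset.sum_congr rfl fun k hk => ?_
    rw [Finset.mul_sum]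
    refine Finset.sum_congr rfl fun j hj => ?_
    rw [← sub_one_mul_sum_ite, mul_assoc (u - 1), mul_assoc (u - 1), Finset.sum_mul,
      Finset.sum_mul]
    refine congrArg _ ?_
    refine Finset.sum_congr rfl fun x hx => ?_
    rw [Finset.mem_range] at hx hj hk
    simp only [box_le_iff hb hc hab hac hbc hx hj hk hs, ite_mul, zero_mul]
  have hdrc : (u ^ a) ^ 2 * drc u⁻¹ v w a b c = u ^ a * ((u - 1) * boxSum u v w a b c 1) +
      (u - 1) * boxSum u v w a b c 2 +
      ∑ k ∈ Finset.range c, ∑ j ∈ Finset.range b, v ^ j * w ^ k := by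
    rw [hbox 1 le_rfl, hbox 2 one_le_two, drc]
    simp only [Finset.mul_sum, ← Finset.sum_add_distrib]
    refine Finset.sum_congr rfl fun k hk => Finset.sum_congr rfl fun j hj => ?_
    rw [Finset.mem_range] at hj hk
    have hf : a * (j * c + k * b) / (b * c) ≤ 2 * a := by
      refine Nat.div_le_of_le_mul ?_
      calc a * (j * c + k * b) ≤ a * (b * c + c * b) := by gcongr
        _ = b * c * (2 * a) := by ring
    rw [floor_eq_natDiv a b c j k hb hc, zpow_natCast, inv_pow]
    generalize a * (j * c + k * b) / (b * c) = f at *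
    have hpow : (u ^ a) ^ 2 * (u ^ f)⁻¹ = u ^ (2 * a - f) := by
      rw [← pow_mul, mul_comm a 2, pow_sub₀ u hu hf]
    rw [mul_assoc ((u ^ f)⁻¹), ← mul_assoc, hpow]
    rcases le_total f a with h | h
    · rw [min_eq_right (by omega), min_eq_left (by omega),
        show 2 * a - f = a + (1 * a - f) by omega, pow_add]
      ring
    · rw [show 1 * a - f = 0 by omega, min_eq_right (by omega), min_eq_right (by omega)]
      ring
  have hprod : ∑ k ∈ Finset.range c, ∑ j ∈ Finset.range b, v ^ j * w ^ k =
      (∑ j ∈ Finset.range b, v ^ j) * ∑ k ∈ Finset.range c, w ^ k := by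
    rw [Finset.sum_comm, Finset.sum_mul_sum]
  rw [hdrc, hprod, ← mul_geom_sum v b, ← mul_geom_sum w c]
  ring

/-! ### Solving the recurrence -/

/-- The third-order linear recurrence with characteristic roots `u ^ a`, `v ^ b`, `w ^ c`. -/
theorem simplexSum_add_three {K : Type*} [Field K] (u v w : K) {a b c : ℕ}
    (ha : 0 < a) (hb : 0 < b) (hc : 0 < c) (t : ℕ) :
    simplexSum u v w a b c (t + 3) (fun _ => True) =
      boxSum u v w a b c (t + 3) +
      (u ^ a + v ^ b + w ^ c) * simplexSum u v w a b c (t + 2) (fun _ => True) -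
      (u ^ a * v ^ b + u ^ a * w ^ c + v ^ b * w ^ c) *
        simplexSum u v w a b c (t + 1) (fun _ => True) +
      u ^ a * v ^ b * w ^ c * simplexSum u v w a b c t (fun _ => True) := by
  have h1 := simplexSum_succ u v w ha hb hc
  have h2 := simplexSum_succ_fst_lt u v w ha hb hc
  have h3 := simplexSum_succ_fst_snd_lt u v w ha hb hc
  rw [← simplexSum_box u v w ha hb hc]
  linear_combination h1 (t + 2) - (v ^ b + w ^ c) * h1 (t + 1) + v ^ b * w ^ c * h1 t +
    h2 (t + 2) - w ^ c * h2 (t + 1) + h3 (t + 2)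

theorem simplexSum_one {K : Type*} [Field K] (u v w : K) {a b c : ℕ}
    (ha : 0 < a) (hb : 0 < b) (hc : 0 < c) :
    simplexSum u v w a b c 1 (fun _ => True) =
      boxSum u v w a b c 1 + u ^ a + v ^ b + w ^ c := by
  have h1 := simplexSum_succ u v w ha hb hc 0
  have h2 := simplexSum_succ_fst_lt u v w ha hb hc 0
  have h3 := simplexSum_succ_fst_snd_lt u v w ha hb hc 0
  have z1 := simplexSum_zero u v w ha hb hc (fun _ => True) trivial
  have z2 := simplexSum_zero u v w ha hb hc (fun m => m.1 < a) ha
  have z3 := simplexSum_zero u v w ha hb hc (fun m => m.1 < a ∧ m.2.1 < b) ⟨ha, hb⟩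
  rw [← simplexSum_box u v w ha hb hc]
  linear_combination h1 + h2 + h3 + u ^ a * z1 + v ^ b * z2 + w ^ c * z3

theorem simplexSum_two {K : Type*} [Field K] (u v w : K) {a b c : ℕ}
    (ha : 0 < a) (hb : 0 < b) (hc : 0 < c) :
    simplexSum u v w a b c 2 (fun _ => True) =
      boxSum u v w a b c 2 +
      (u ^ a + v ^ b + w ^ c) * simplexSum u v w a b c 1 (fun _ => True) -
      (u ^ a * v ^ b + u ^ a * w ^ c + v ^ b * w ^ c) := by
  have h1 := simplexSum_succ u v w ha hb hc
  have h2 := simplexSum_succ_fst_lt u v w ha hb hc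
  have h3 := simplexSum_succ_fst_snd_lt u v w ha hb hc
  have z1 := simplexSum_zero u v w ha hb hc (fun _ => True) trivial
  have z2 := simplexSum_zero u v w ha hb hc (fun m => m.1 < a) ha
  rw [← simplexSum_box u v w ha hb hc]
  linear_combination h1 1 - (v ^ b + w ^ c) * h1 0 + h2 1 - w ^ c * h2 0 + h3 1
    - (v ^ b + w ^ c) * u ^ a * z1 - w ^ c * v ^ b * z2

/-- The identity for `simplexSum`, valid for every `t`, with the coefficients of the powers of
`u ^ a`, `v ^ b`, `w ^ c` expressed through the box sums of the first two dilates. -/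
theorem simplexSum_formula {K : Type*} [Field K] (u v w : K) {a b c : ℕ}
    (ha : 0 < a) (hb : 0 < b) (hc : 0 < c) (t : ℕ) :
    (u - 1) * (v - 1) * (w - 1) * (u ^ a - v ^ b) * (u ^ a - w ^ c) * (v ^ b - w ^ c) *
        simplexSum u v w a b c t (fun _ => True) =
      (u ^ a) ^ t * (v ^ b - w ^ c) * ((u - 1) * (v - 1) * (w - 1) * ((u ^ a) ^ 2 +
          u ^ a * boxSum u v w a b c 1 + boxSum u v w a b c 2) + (v ^ b - 1) * (w ^ c - 1))
        - (v ^ b) ^ t * (u ^ a - w ^ c) * ((u - 1) * (v - 1) * (w - 1) * ((v ^ b) ^ 2 +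
          v ^ b * boxSum u v w a b c 1 + boxSum u v w a b c 2) + (u ^ a - 1) * (w ^ c - 1))
        + (w ^ c) ^ t * (u ^ a - v ^ b) * ((u - 1) * (v - 1) * (w - 1) * ((w ^ c) ^ 2 +
          w ^ c * boxSum u v w a b c 1 + boxSum u v w a b c 2) + (u ^ a - 1) * (v ^ b - 1))
        - (u ^ a - v ^ b) * (u ^ a - w ^ c) * (v ^ b - w ^ c) := by
  have h0 := simplexSum_zero u v w ha hb hc (fun _ => True) trivial
  have h1 := simplexSum_one u v w ha hb hc
  have h2 := simplexSum_two u v w ha hb hc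
  have h3 := simplexSum_add_three u v w ha hb hc
  have hbox (s : ℕ) := boxSum_eq_of_three_le u v w a b c (s := s + 3) (by omega)
  generalize u ^ a = A at *
  generalize v ^ b = B at *
  generalize w ^ c = C at *
  induction t using Nat.strong_induction_on with
  | _ t ih =>
    match t with
    | 0 => rw [h0]; ring
    | 1 => rw [h1]; ring
    | 2 => rw [h2, h1]; ring
    | t + 3 =>
      have e0 := ih t (by omega)
      have e1 := ih (t + 1) (by omega)
      have e2 := ih (t + 2) (by omega)
      rw [h3 t]
      linear_combination (A + B + C) * e2 - (A * B + A * C + B * C) * e1 + A * B * C * e0 +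
        (A - B) * (A - C) * (B - C) * hbox t

theorem mainTheorem2 {K : Type*} [Field K] (u v w : K) (hu : u ≠ 0) (hv : v ≠ 0) (hw : w ≠ 0)
    (a b c : ℕ) (ha : 0 < a) (hb : 0 < b) (hc : 0 < c)
    (hab : Nat.Coprime a b) (hac : Nat.Coprime a c) (hbc : Nat.Coprime b c)
    (t : ℕ) (ht : 0 < t) :
    (u - 1) * (v - 1) * (w - 1) * (u ^ a - v ^ b) * (u ^ a - w ^ c) * (v ^ b - w ^ c) *
        integerPointTransform ((t : ℝ) • tetrahedron a b c) ![u, v, w] =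
      u ^ ((t + 2) * a) * (v - 1) * (w - 1) * (v ^ b - w ^ c) *
          ((u - 1) + drc u⁻¹ v w a b c)
        - v ^ ((t + 2) * b) * (u - 1) * (w - 1) * (u ^ a - w ^ c) *
          ((v - 1) + drc v⁻¹ u w b a c)
        + w ^ ((t + 2) * c) * (u - 1) * (v - 1) * (u ^ a - v ^ b) *
          ((w - 1) + drc w⁻¹ u v c a b)
        - (u ^ a - v ^ b) * (u ^ a - w ^ c) * (v ^ b - w ^ c) := by
  have hA := pow_mul_drc_inv v w hu hb hc hab hac hbc
  have hB := pow_mul_drc_inv u w hv ha hc hab.symm hbc hac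
  have hC := pow_mul_drc_inv u v hw ha hb hac.symm hbc.symm hab
  have hswap (s : ℕ) : boxSum w u v c a b s = boxSum u v w a b c s := by
    rw [boxSum_swap_left, boxSum_swap_right]
  simp only [boxSum_swap_left u v w a b c] at hB
  simp only [hswap] at hC
  rw [integerPointTransform_smul_tetrahedron u v w ha hb hc ht,
    simplexSum_formula u v w ha hb hc t]
  simp only [mul_comm (t + 2), pow_mul, pow_add]
  linear_combination -(u ^ a) ^ t * (v ^ b - w ^ c) * hA + (v ^ b) ^ t * (u ^ a - w ^ c) * hB -
    (w ^ c) ^ t * (u ^ a - v ^ b) * hC
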